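/- **Setting.** Let $n,\Delta$ be natural numbers. A *network* is a graph whose vertices carry distinct IDs from $\{0,\dots,n-1\}$ (so there are at most $n$ vertices) and whose maximum degree is at most $\Delta$. A (deterministic, locally-iterative) *algorithm* for $(n,\Delta)$ consists of a palette $\{0,\dots,M-1\}$ with $M\ge \Delta+1$ and an update rule. The RAM of each vertex holds one color of the palette; in each synchronous round each vertex computes its next color from its ID, its current color and the set of current colors of its neighbors (the bounds $n$ and $\Delta$ and the program are hard-wired). In the *fully-dynamic self-stabilizing* setting, in every round an adversary may in addition change the RAM of any vertices arbitrarily (*faults*), and may let vertices appear or crash and change links arbitrarily (*dynamic updates*), as long as the bounds $n$ and $\Delta$ hold. A vertex is *disturbed* in a round if its RAM contents after the round is not the color computed by the algorithm, or if it appears or crashes, or if its set of neighbors changes in this round. The *stabilization time* is at most $T$ if, in every execution, at every time that is at least $T$ rounds after the last fault or dynamic update, the colors form a proper coloring of the current graph with the $\Delta+1$ colors $0,\dots,\Delta$. The *adjustment radius* is the maximum, over all executions in which the colors at some time $t_0$ form a proper coloring with colors $0,\dots,\Delta$ and over all vertices $v$ present at time $t_0$ whose color at some later time differs from that at time $t_0$,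 of the distance (in the network at time $t_0$) from $v$ to the closest vertex that is disturbed at or after time $t_0$ (the distance is $\infty$ if there is no such vertex). The function $\log^* n$ is the number of times $\log_2$ has to be applied, starting from $n$, until a number smaller than $2$ is reached. **Theorem.** There are a constant $C$ and, for all $n,\Delta\ge 0$, an algorithm as above with palette size $M\le (n+\Delta+2)^C$ (that is, a color fits into $O(1)$ words of $O(\log(n+\Delta))$ bits) such that 1. its stabilization time is at most $C\cdot(\Delta+\log^* n)$; moreover, once faults and dynamic updates have stopped, the coloring is proper at the end of each round; 2. its adjustment radius is at most $1$, and it is exactly $1$ whenever $n\ge 2$ and $\Delta\ge 1$. -/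

import Mathlib

namespace SelfStab

/-- `log* x`: the number of times `log₂` has to be applied iteratively, starting from `x`,
until a number smaller than `2` is reached. -/
noncomputable def logStar (x : ℝ) : ℕ :=
  sInf {k : ℕ | (Real.logb 2)^[k] x < 2}

/-- The communication network during one round: a graph on at most `n` vertices, each of degree at
most `Δ`. A vertex is identified with its unique ID in `{0, …, n - 1}`; `verts` is the set of
vertices that are currently present. -/
structure Network (n Δ : ℕ) where
  verts : Set (Fin n)
  graph : SimpleGraph (Fin n)
  mem_of_adj : ∀ u v, graph.Adj u v → u ∈ verts
  degree_le : ∀ v, (graph.neighborSet v).ncard ≤ Δ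

/-- A deterministic locally-iterative colouring algorithm for the bounds `n` and `Δ` (which are
hard-wired, together with the ID and the program, in the ROM). The RAM of a vertex holds one colour
from `{0, …, palette - 1}`. In each round a vertex computes its next colour from its own ID, its
current colour and the set of the current colours of its neighbours. -/
structure Algorithm (n Δ : ℕ) where
  palette : ℕ
  le_palette : Δ + 1 ≤ palette
  next : Fin n → Fin palette → Set (Fin palette) → Fin palette

namespace Algorithm

variable {n Δ : ℕ} (A : Algorithm n Δ)

/-- The contents of the RAM of all vertices. (Entries of absent vertices are irrelevant.) -/
abbrev Coloring : Type := Fin n → Fin A.palette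

/-- The colour that the algorithm computes for `v` in one round. -/
def step (G : Network n Δ) (c : A.Coloring) (v : Fin n) : Fin A.palette :=
  A.next v (c v) (c '' G.graph.neighborSet v)

/-- A run in an adversarial environment: the network and the RAM contents at the beginning of each
round. There is no constraint between consecutive rounds, since any deviation from the program is
a fault, see `Disturbed`. -/
structure Execution where
  net : ℕ → Network n Δ
  ram : ℕ → A.Coloring

variable {A}

namespace Execution

variable (e : A.Execution)

/-- In round `t` the vertex `v` undergoes a dynamic update (it appears or crashes, or one of its
links changes) or a fault (its new RAM contents is not the one computed by the algorithm). -/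
def Disturbed (t : ℕ) (v : Fin n) : Prop :=
  ¬ (v ∈ (e.net t).verts ↔ v ∈ (e.net (t + 1)).verts) ∨
  (e.net t).graph.neighborSet v ≠ (e.net (t + 1)).graph.neighborSet v ∨
  (v ∈ (e.net (t + 1)).verts ∧ e.ram (t + 1) v ≠ A.step (e.net t) (e.ram t) v)

/-- The vertices that undergo a fault or a dynamic update in some round `t ≥ t₀`. -/
def disturbedSince (t₀ : ℕ) : Set (Fin n) :=
  {v | ∃ t, t₀ ≤ t ∧ e.Disturbed t v}

/-- No faults and no dynamic updates occur in the rounds `t ≥ t₀`. -/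
def QuietFrom (t₀ : ℕ) : Prop :=
  e.disturbedSince t₀ = ∅

/-- At the beginning of round `t` adjacent vertices hold distinct colours. -/
def ProperAt (t : ℕ) : Prop :=
  ∀ u v, (e.net t).graph.Adj u v → e.ram t u ≠ e.ram t v

/-- At the beginning of round `t` the vertices hold a proper colouring with the `Δ + 1` colours
`0, …, Δ`. -/
def SolvedAt (t : ℕ) : Prop :=
  e.ProperAt t ∧ ∀ v ∈ (e.net t).verts, (e.ram t v : ℕ) < Δ + 1

end Execution

variable (A)

/-- The stabilization time of `A` is at most `T`: whatever happened before, from `T` rounds after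
the last fault or dynamic update on, the colouring is a proper `(Δ + 1)`-colouring. -/
def StabilizesWithin (T : ℕ) : Prop :=
  ∀ (e : A.Execution) (t₀ : ℕ), e.QuietFrom t₀ → ∀ t, t₀ + T ≤ t → e.SolvedAt t

/-- Once faults and dynamic updates have stopped, the colouring is proper at the end of each
round. -/
def ProperInEachRound : Prop :=
  ∀ (e : A.Execution) (t₀ : ℕ), e.QuietFrom t₀ → ∀ t, t₀ + 1 ≤ t → e.ProperAt t

/-- The adjustment radius: the maximum, over all executions that are in a solved state at some time
`t₀` and all vertices `v` that change their colour later on, of the distance from `v` to the closest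
vertex with a fault or a dynamic update since `t₀` (`⊤` if there is none). Distances are measured at
time `t₀`; as links of undisturbed vertices do not change, the distance from `v` to the set of
disturbed vertices is the same in all later networks. -/
noncomputable def adjustmentRadius : ℕ∞ :=
  ⨆ (e : A.Execution) (t₀ : ℕ) (_ : e.SolvedAt t₀) (v : Fin n) (_ : v ∈ (e.net t₀).verts)
    (_ : ∃ t, t₀ ≤ t ∧ e.ram t v ≠ e.ram t₀ v),
    ⨅ u ∈ e.disturbedSince t₀, (e.net t₀).graph.edist v u

end Algorithm

end SelfStab

namespace SelfStab

/-! A vertex that detects a conflict is reset to its ID and then descends through four kinds of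
states. On the chain `lin` it runs Linial's reduction, from ID-sized colours to a palette polynomial
in Δ, in about log* n rounds. It then enters a pair `work a b` over a prime field with q = O(Δ)
elements and rotates b to a + b until no neighbour holds b. At that point it freezes as `post b`,
waits until b is a local maximum among the posted neighbours, and takes a free final colour, which
it keeps unless a conflict arises.

The key fact is `next_ne`: one round makes adjacent vertices differ, whatever the RAM held before.
Hence resets stop after one fault-free round, and `Run.ne_lin`, `Run.ne_work` and
`Run.val_add_lt_of_post` bound the time spent in each kind of state by `depth + 2`, 2Δ + 1 and q
rounds.

The same fact bounds the adjustment radius: an undisturbed neighbour of a vertex with a final colour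
never moves onto that colour, so only a disturbance at the vertex or at a neighbour can make it
change.

The size bounds come from low-degree polynomials, which rarely agree (`exists_reduction`), and from
comparing bit lengths with iterated logarithms (`bits_le`). -/

/-- The data of the colour reduction: a chain of one-round colour reductions between palettes of
sizes `size 0, …, size depth`, followed by a reduction to pairs of elements of a prime field. -/
structure ReductionScheme (n Δ : ℕ) where
  q : ℕ
  prime : Fact q.Prime
  two_mul_lt : 2 * Δ < q
  depth : ℕ
  size : ℕ → ℕ
  ident : Fin n → Fin (size 0)
  ident_injective : Function.Injective ident
  reduce : ∀ k, Fin (size k) → Set (Fin (size k)) → Fin (size (k + 1))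
  reduce_ne : ∀ k a b A B, a ≠ b → b ∈ A → a ∈ B → A.ncard ≤ Δ → B.ncard ≤ Δ →
    reduce k a A ≠ reduce k b B
  enter : ∀ k, Fin (size k) → Set (Fin (size k)) → Set (ZMod q) → ZMod q × ZMod q
  -- The equation `k = depth` is a hypothesis so that a level known to be last only through its
  -- value can be used without transporting colours between types.
  enter_fst : ∀ k, k = depth → ∀ a A F, A.ncard ≤ Δ → F.ncard ≤ Δ →
    (enter k a A F).1 ≠ 0 ∧ (enter k a A F).1 ∉ F
  enter_ne : ∀ k, k = depth → ∀ a b A B F F', a ≠ b → b ∈ A → a ∈ B → A.ncard ≤ Δ → B.ncard ≤ Δ →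
    F.ncard ≤ Δ → F'.ncard ≤ Δ → enter k a A F ≠ enter k b B F'

namespace ReductionScheme

variable {n Δ : ℕ} (S : ReductionScheme n Δ)

instance : Fact S.q.Prime := S.prime

/-! ### The state machine -/

/-- The state of a vertex: one of the final colours, a colour in the prime field that waits for its
turn, a pair that rotates its second entry, or a colour of the chain of reductions. -/
inductive State
  | final (i : Fin (Δ + 1))
  | post (b : ZMod S.q)
  | work (a b : ZMod S.q)
  | lin (k : Fin (S.depth + 1)) (c : Fin (S.size k))

/-- The states other than the final colours, as a sum type. -/
abbrev Pending : Type :=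
  ZMod S.q ⊕ (ZMod S.q × ZMod S.q) ⊕ (Σ k : Fin (S.depth + 1), Fin (S.size k))

/-- The states as a sum type. -/
def stateEquivSum : S.State ≃ Fin (Δ + 1) ⊕ S.Pending where
  toFun
    | .final i => .inl i
    | .post b => .inr (.inl b)
    | .work a b => .inr (.inr (.inl (a, b)))
    | .lin k c => .inr (.inr (.inr ⟨k, c⟩))
  invFun
    | .inl i => .final i
    | .inr (.inl b) => .post b
    | .inr (.inr (.inl x)) => .work x.1 x.2
    | .inr (.inr (.inr x)) => .lin x.1 x.2
  left_inv := by rintro (i | b | ⟨a, b⟩ | ⟨k, c⟩) <;> rfl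
  right_inv := by rintro (i | b | ⟨a, b⟩ | ⟨k, c⟩) <;> rfl

instance : Finite S.State := Finite.of_equiv _ S.stateEquivSum.symm

variable {S}

/-- A neighbour of a vertex with second entry `b` has the second entry `b` or the colour `b`. -/
def Blocked (b : ZMod S.q) (N : Set S.State) : Prop :=
  .post b ∈ N ∨ ∃ a, .work a b ∈ N

/-- The state is distinct from the states of the neighbours and no pair with first entry `0`. -/
def Valid (s : S.State) (N : Set S.State) : Prop :=
  s ∉ N ∧ ∀ b, s ≠ .work 0 b

/-- The colours of the neighbours on level `k` of the chain of reductions. -/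
def levelColors (N : Set S.State) (k : Fin (S.depth + 1)) : Set (Fin (S.size k)) :=
  {b | .lin k b ∈ N}

/-- The first entries of the pairs of the neighbours. -/
def slopes (N : Set S.State) : Set (ZMod S.q) :=
  {a | ∃ b, .work a b ∈ N}

open Classical in
/-- The next state of a vertex in a valid state. -/
noncomputable def advance (s : S.State) (N : Set S.State) : S.State :=
  match s with
  | .final i => .final i
  | .post b =>
    if ∃ b' : ZMod S.q, b.val < b'.val ∧ .post b' ∈ N then .post b
    -- With at most Δ neighbour states one of the Δ + 1 final colours is free, so the default
    -- `.final 0` is never used.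
    else if h : ∃ i, .final i ∉ N then .final h.choose else .final 0
  | .work a b => if Blocked b N then .work a (a + b) else .post b
  | .lin k c =>
    if h : k < S.depth then .lin ⟨k + 1, Nat.succ_lt_succ h⟩ (S.reduce k c (levelColors N k))
    else .work (S.enter k c (levelColors N k) (slopes N)).1
      (S.enter k c (levelColors N k) (slopes N)).2

/-- The state to which a vertex is reset. -/
def reset (S : ReductionScheme n Δ) (v : Fin n) : S.State :=
  .lin ⟨0, Nat.succ_pos _⟩ (S.ident v)

open Classical in
/-- The next state of a vertex. -/
noncomputable def next (v : Fin n) (s : S.State) (N : Set S.State) : S.State :=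
  if Valid s N then advance s N else S.reset v

/-! ### Adjacent vertices differ after one round -/

theorem next_of_valid {v : Fin n} {s : S.State} {N : Set S.State} (h : Valid s N) :
    next v s N = advance s N := if_pos h

theorem next_of_not_valid {v : Fin n} {s : S.State} {N : Set S.State} (h : ¬ Valid s N) :
    next v s N = S.reset v := if_neg h

theorem ncard_levelColors_le (N : Set S.State) (k : Fin (S.depth + 1)) :
    (levelColors N k).ncard ≤ N.ncard :=
  Set.ncard_le_ncard_of_injOn (fun b => State.lin k b) (fun _ h => h)
    (fun a _ b _ h => by simpa using h) (Set.toFinite N)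

theorem ncard_slopes_le (N : Set S.State) : (slopes N).ncard ≤ N.ncard := by
  let g : S.State → ZMod S.q := fun s => match s with
    | .work a _ => a
    | _ => 0
  refine (Set.ncard_le_ncard ?_ ((Set.toFinite N).image g)).trans
    (Set.ncard_image_le (Set.toFinite N))
  rintro a ⟨b, h⟩
  exact ⟨_, h, rfl⟩

theorem exists_final_notMem {N : Set S.State} (hN : N.ncard ≤ Δ) : ∃ i, State.final i ∉ N := by
  by_contra! h
  have := Set.ncard_le_ncard_of_injOn (s := (Set.univ : Set (Fin (Δ + 1)))) (t := N)
    (fun i => State.final i) (fun i _ => h i) (fun a _ b _ h => by simpa using h) (Set.toFinite N)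
  simp at this
  omega

theorem advance_eq_final {s : S.State} {N : Set S.State} (hN : N.ncard ≤ Δ) {i : Fin (Δ + 1)}
    (h : advance s N = .final i) : s = .final i ∨ .final i ∉ N ∧
      ∃ b, s = .post b ∧ ∀ b' : ZMod S.q, b.val < b'.val → .post b' ∉ N := by
  rcases s with j | b | ⟨a, b⟩ | ⟨k, c⟩ <;> simp only [advance] at h
  · exact .inl h
  · split_ifs at h with h1 h2
    · push Not at h1
      have h3 := h2.choose_spec
      rw [State.final.inj h] at h3
      exact .inr ⟨h3, b, rfl, h1⟩
    · exact absurd (exists_final_notMem hN) h2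
  · split_ifs at h
  · split_ifs at h

theorem advance_eq_post {s : S.State} {N : Set S.State} {b : ZMod S.q}
    (h : advance s N = .post b) :
    (s = .post b ∧ ∃ b' : ZMod S.q, b.val < b'.val ∧ .post b' ∈ N) ∨
      ∃ a, s = .work a b ∧ ¬ Blocked b N := by
  rcases s with j | b | ⟨a, b⟩ | ⟨k, c⟩ <;> simp only [advance] at h
  · cases h
  · split_ifs at h with h1 h2
    exact .inl ⟨h, State.post.inj h ▸ h1⟩
  · split_ifs at h with h1
    cases h
    exact .inr ⟨a, rfl, h1⟩
  · split_ifs at h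

theorem advance_eq_work {s : S.State} {N : Set S.State} {a b : ZMod S.q}
    (h : advance s N = .work a b) :
    (∃ b', s = .work a b' ∧ b = a + b' ∧ Blocked b' N) ∨
      ∃ k c, s = .lin k c ∧ (k : ℕ) = S.depth ∧
        S.enter k c (levelColors N k) (slopes N) = (a, b) := by
  rcases s with j | b | ⟨a, b⟩ | ⟨k, c⟩ <;> simp only [advance] at h
  · cases h
  · split_ifs at h
  · split_ifs at h with h1
    cases h
    exact .inl ⟨b, rfl, rfl, h1⟩
  · split_ifs at h with h1
    obtain ⟨h2, h3⟩ := State.work.inj h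
    exact .inr ⟨k, c, rfl, by omega, Prod.ext h2 h3⟩

theorem advance_eq_lin {s : S.State} {N : Set S.State} {k : Fin (S.depth + 1)}
    {c : Fin (S.size k)} (h : advance s N = .lin k c) :
    ∃ (k' : Fin (S.depth + 1)) (c' : Fin (S.size k')) (h : (k' : ℕ) < S.depth), s = .lin k' c' ∧
      State.lin k c = .lin ⟨k' + 1, Nat.succ_lt_succ h⟩ (S.reduce k' c' (levelColors N k')) := by
  rcases s with j | b | ⟨a, b⟩ | ⟨k, c⟩ <;> simp only [advance] at h
  · cases h
  · split_ifs at h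
  · split_ifs at h
  · split_ifs at h with h1
    exact ⟨k, c, h1, rfl, h.symm⟩

/-- Advancing along the chain lands on a level at least 1, whereas resets land on level 0. -/
theorem advance_ne_reset (s : S.State) (N : Set S.State) (v : Fin n) :
    advance s N ≠ S.reset v := by
  intro h
  obtain ⟨k, c, hk, -, h2⟩ := advance_eq_lin h
  have := congrArg Fin.val (State.lin.inj h2).1
  simp at this

/-- Equal results are traced back to the possible predecessors. A new final colour avoids the final
neighbours, and adjacent posted vertices are not both local maxima. A newly posted value is not
blocked by the neighbour. Equal slopes preserve the difference of second entries, a newcomer avoids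
the slopes already present, and simultaneous newcomers are separated by `enter_ne`. -/
theorem advance_ne {s t : S.State} {N M : Set S.State} (hs : Valid s N) (ht : Valid t M)
    (htN : t ∈ N) (hsM : s ∈ M) (hN : N.ncard ≤ Δ) (hM : M.ncard ≤ Δ) :
    advance s N ≠ advance t M := by
  have hst : s ≠ t := fun h => hs.1 (h ▸ htN)
  intro h
  rcases hx : advance t M with i | b | ⟨a, b⟩ | ⟨k, c⟩ <;> rw [hx] at h
  · rcases advance_eq_final hN h with rfl | ⟨h1, b, rfl, h2⟩ <;>
      rcases advance_eq_final hM hx with rfl | ⟨h3, b', rfl, h4⟩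
    · exact hst rfl
    · exact h3 hsM
    · exact h1 htN
    · rcases lt_trichotomy b.val b'.val with h5 | h5 | h5
      · exact h2 _ h5 htN
      · exact hst (congrArg _ (ZMod.val_injective _ h5))
      · exact h4 _ h5 hsM
  · rcases advance_eq_post h with ⟨rfl, -⟩ | ⟨a, rfl, h2⟩ <;>
      rcases advance_eq_post hx with ⟨rfl, -⟩ | ⟨a', rfl, h4⟩
    · exact hst rfl
    · exact h4 (.inl hsM)
    · exact h2 (.inl htN)
    · exact h2 (.inr ⟨_, htN⟩)
  · have hA := fun k => (ncard_levelColors_le N k).trans hN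
    have hB := fun k => (ncard_levelColors_le M k).trans hM
    have hF := (ncard_slopes_le N).trans hN
    have hF' := (ncard_slopes_le M).trans hM
    rcases advance_eq_work h with ⟨b1, rfl, h1, -⟩ | ⟨k, c, rfl, hk, h2⟩ <;>
      rcases advance_eq_work hx with ⟨b2, rfl, h3, -⟩ | ⟨k', c', rfl, hk', h4⟩
    · exact hst (congrArg _ (add_left_cancel (h1.symm.trans h3)))
    · have := (S.enter_fst k' hk' c' _ _ (hB k') hF').2
      rw [h4] at this
      exact this ⟨_, hsM⟩
    · have := (S.enter_fst k hk c _ _ (hA k) hF).2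
      rw [h2] at this
      exact this ⟨_, htN⟩
    · obtain rfl : k = k' := Fin.ext (hk.trans hk'.symm)
      exact S.enter_ne k hk c c' _ _ _ _ (fun e => hst (congrArg _ e)) htN hsM (hA k) (hB k) hF hF'
        (h2.trans h4.symm)
  · obtain ⟨k1, c1, hk1, rfl, h1⟩ := advance_eq_lin h
    obtain ⟨k2, c2, hk2, rfl, h2⟩ := advance_eq_lin hx
    have h3 := h1.symm.trans h2
    obtain rfl : k1 = k2 := by
      have := congrArg Fin.val (State.lin.inj h3).1
      exact Fin.ext (by simpa using this)
    exact S.reduce_ne k1 c1 c2 _ _ (fun e => hst (congrArg _ e)) htN hsM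
      ((ncard_levelColors_le N k1).trans hN) ((ncard_levelColors_le M k1).trans hM)
      (by simpa using h3)

/-- The old states may be arbitrary, even equal: invalid vertices are reset to distinct IDs, which
no advancing vertex reaches. -/
theorem next_ne {v u : Fin n} (hvu : v ≠ u) {s t : S.State} {N M : Set S.State}
    (htN : t ∈ N) (hsM : s ∈ M) (hN : N.ncard ≤ Δ) (hM : M.ncard ≤ Δ) :
    next v s N ≠ next u t M := by
  by_cases hs : Valid s N <;> by_cases ht : Valid t M
  · rw [next_of_valid hs, next_of_valid ht]
    exact advance_ne hs ht htN hsM hN hM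
  · rw [next_of_valid hs, next_of_not_valid ht]
    exact advance_ne_reset _ _ _
  · rw [next_of_not_valid hs, next_of_valid ht]
    exact (advance_ne_reset _ _ _).symm
  · rw [next_of_not_valid hs, next_of_not_valid ht]
    intro h
    exact hvu (S.ident_injective (eq_of_heq (State.lin.inj h).2))

theorem next_ne_work_zero {v : Fin n} {s : S.State} {N : Set S.State} (hN : N.ncard ≤ Δ)
    (b : ZMod S.q) : next v s N ≠ .work 0 b := by
  by_cases hs : Valid s N
  · rw [next_of_valid hs]
    intro h
    rcases advance_eq_work h with ⟨b', rfl, -⟩ | ⟨k, c, rfl, hk, h2⟩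
    · exact hs.2 _ rfl
    · have := (S.enter_fst k hk c _ _ ((ncard_levelColors_le N k).trans hN)
        ((ncard_slopes_le N).trans hN)).1
      rw [h2] at this
      exact this rfl
  · rw [next_of_not_valid hs]
    exact fun h => by cases h

theorem next_final {v : Fin n} {i : Fin (Δ + 1)} {N : Set S.State} (h : .final i ∉ N) :
    next v (.final i) N = .final i :=
  next_of_valid ⟨h, fun _ h => by cases h⟩

/-! ### Convergence on a fixed network -/

/-- The states of the neighbours of `v`. -/
def neighborStates (G : SimpleGraph (Fin n)) (σ : Fin n → S.State) (v : Fin n) : Set S.State :=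
  σ '' G.neighborSet v

theorem mem_neighborStates {G : SimpleGraph (Fin n)} {σ : Fin n → S.State} {v : Fin n}
    {s : S.State} : s ∈ neighborStates G σ v ↔ ∃ u, G.Adj v u ∧ σ u = s := Iff.rfl

variable (S) in
/-- A run of the algorithm on a fixed network. -/
structure Run (G : Network n Δ) (σ : ℕ → Fin n → S.State) : Prop where
  succ : ∀ t, ∀ v ∈ G.verts, σ (t + 1) v = next v (σ t v) (neighborStates G.graph (σ t) v)

theorem ncard_neighborStates_le (G : Network n Δ) (σ : Fin n → S.State) (v : Fin n) :
    (neighborStates G.graph σ v).ncard ≤ Δ :=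
  (Set.ncard_image_le (Set.toFinite _)).trans (G.degree_le v)

theorem next_neighborStates_ne (G : Network n Δ) (σ : Fin n → S.State) {u v : Fin n}
    (h : G.graph.Adj u v) :
    next u (σ u) (neighborStates G.graph σ u) ≠ next v (σ v) (neighborStates G.graph σ v) :=
  next_ne h.ne (mem_neighborStates.2 ⟨v, h, rfl⟩) (mem_neighborStates.2 ⟨u, h.symm, rfl⟩)
    (ncard_neighborStates_le G σ u) (ncard_neighborStates_le G σ v)

namespace Run

variable {G : Network n Δ} {σ : ℕ → Fin n → S.State}

theorem proper (h : Run S G σ) {t : ℕ} (ht : 1 ≤ t) {u v : Fin n} (huv : G.graph.Adj u v) :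
    σ t u ≠ σ t v := by
  obtain ⟨t, rfl⟩ := Nat.exists_eq_add_of_le' ht
  rw [h.succ t u (G.mem_of_adj _ _ huv), h.succ t v (G.mem_of_adj _ _ huv.symm)]
  exact next_neighborStates_ne G (σ t) huv

theorem valid (h : Run S G σ) {t : ℕ} (ht : 1 ≤ t) {v : Fin n} (hv : v ∈ G.verts) :
    Valid (σ t v) (neighborStates G.graph (σ t) v) := by
  constructor
  · rintro ⟨u, hu, huv⟩
    exact h.proper ht hu huv.symm
  · obtain ⟨t, rfl⟩ := Nat.exists_eq_add_of_le' ht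
    rw [h.succ t v hv]
    exact next_ne_work_zero (ncard_neighborStates_le G (σ t) v)

theorem succ_eq_advance (h : Run S G σ) {t : ℕ} (ht : 1 ≤ t) {v : Fin n} (hv : v ∈ G.verts) :
    σ (t + 1) v = advance (σ t v) (neighborStates G.graph (σ t) v) := by
  rw [h.succ t v hv, next_of_valid (h.valid ht hv)]

/-- From time 1 on nothing is reset, so a vertex still on the chain has climbed one level per round.
-/
theorem le_level (h : Run S G σ) (j : ℕ) {v : Fin n} (hv : v ∈ G.verts)
    {k : Fin (S.depth + 1)} {c : Fin (S.size k)} (hk : σ (1 + j) v = .lin k c) : j ≤ k := by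
  induction j generalizing k with
  | zero => exact Nat.zero_le _
  | succ j ih =>
    rw [← add_assoc, h.succ_eq_advance (by omega) hv] at hk
    obtain ⟨k', c', hk', h1, h2⟩ := advance_eq_lin hk
    have := ih h1
    rw [(State.lin.inj h2).1]
    exact Nat.succ_le_succ this

theorem ne_lin (h : Run S G σ) {t : ℕ} (ht : S.depth + 2 ≤ t) {v : Fin n} (hv : v ∈ G.verts)
    (k : Fin (S.depth + 1)) (c : Fin (S.size k)) : σ t v ≠ .lin k c := by
  obtain ⟨j, rfl⟩ : ∃ j, t = 1 + j := ⟨t - 1, by omega⟩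
  intro h1
  have := h.le_level j hv h1
  have := k.2
  omega

theorem work_of_succ (h : Run S G σ) {t : ℕ} (ht : S.depth + 2 ≤ t) {v : Fin n} (hv : v ∈ G.verts)
    {a b : ZMod S.q} (h1 : σ (t + 1) v = .work a b) :
    ∃ b', σ t v = .work a b' ∧ b = a + b' ∧ Blocked b' (neighborStates G.graph (σ t) v) := by
  rw [h.succ_eq_advance (by omega) hv] at h1
  rcases advance_eq_work h1 with h2 | ⟨k, c, h2, -⟩
  · exact h2
  · exact absurd h2 (h.ne_lin ht hv k c)

theorem work_of_work (h : Run S G σ) {t : ℕ} (ht : S.depth + 2 ≤ t) {v : Fin n}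
    (hv : v ∈ G.verts) (j : ℕ) {a b : ZMod S.q} (h1 : σ (t + j) v = .work a b) :
    ∃ b', σ t v = .work a b' ∧ b = j * a + b' := by
  induction j generalizing b with
  | zero => exact ⟨b, h1, by simp⟩
  | succ j ih =>
    obtain ⟨b1, h2, rfl, -⟩ := h.work_of_succ (t := t + j) (by omega) hv h1
    obtain ⟨b', h3, rfl⟩ := ih h2
    exact ⟨b', h3, by push_cast; ring⟩

theorem post_of_post (h : Run S G σ) {t j : ℕ} (ht : S.depth + 2 ≤ t) {v : Fin n}
    (hv : v ∈ G.verts) {b b' : ZMod S.q} (h0 : σ t v = .post b')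
    (h1 : σ (t + j) v = .post b) : b = b' := by
  induction j generalizing b with
  | zero => exact State.post.inj (h1.symm.trans h0)
  | succ j ih =>
    rw [← add_assoc, h.succ_eq_advance (by omega) hv] at h1
    rcases advance_eq_post h1 with ⟨h2, -⟩ | ⟨a, h2, -⟩
    · exact ih h2
    · obtain ⟨b1, h3, -⟩ := h.work_of_work ht hv j h2
      rw [h0] at h3
      cases h3

/-- A pair that survives 2Δ + 1 rounds is blocked in each of them. A neighbour blocks it at most
once while posted, since its value is then fixed and a ≠ 0, and at most once while rotating, since
two meetings would force equal slopes and hence equal adjacent states. This allows at most 2Δ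
blocked rounds. -/
theorem ne_work (h : Run S G σ) {t : ℕ} (ht : S.depth + 2 + (2 * Δ + 1) ≤ t) {v : Fin n}
    (hv : v ∈ G.verts) (a b : ZMod S.q) : σ t v ≠ .work a b := by
  classical
  intro h1
  obtain ⟨T, hT, rfl⟩ : ∃ T, S.depth + 2 ≤ T ∧ t = T + (2 * Δ + 1) :=
    ⟨t - (2 * Δ + 1), by omega, by omega⟩
  obtain ⟨b₀, h0, -⟩ := h.work_of_work hT hv _ h1
  have ha : a ≠ 0 := by
    rintro rfl
    exact (h.valid (by omega) hv).2 _ h1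
  have hwork : ∀ j ≤ 2 * Δ + 1, σ (T + j) v = .work a (j * a + b₀) := by
    intro j hj
    obtain ⟨i, hi⟩ := Nat.exists_eq_add_of_le hj
    rw [hi, ← add_assoc] at h1
    obtain ⟨b1, h2, -⟩ := h.work_of_work (by omega) hv i h1
    obtain ⟨b2, h3, rfl⟩ := h.work_of_work hT hv j h2
    rw [h0] at h3
    rw [h2, (State.work.inj h3).2]
  -- The Boolean records whether the blocking neighbour is posted (`true`) or rotating, so the
  -- pigeonhole has at most 2Δ holes.
  have hblocked : ∀ j : Fin (2 * Δ + 1), ∃ x : Fin n × Bool, G.graph.Adj v x.1 ∧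
      (if x.2 then σ (T + j) x.1 = .post (j * a + b₀)
        else ∃ a', σ (T + j) x.1 = .work a' (j * a + b₀)) := by
    intro j
    obtain ⟨b', h2, -, h3⟩ := h.work_of_succ (t := T + j) (by omega) hv
      (hwork (j + 1) (by omega))
    rw [hwork j (by omega)] at h2
    rw [← (State.work.inj h2).2] at h3
    rcases h3 with ⟨u, hu, h4⟩ | ⟨a', u, hu, h4⟩
    · exact ⟨(u, true), hu, by simpa using h4⟩
    · exact ⟨(u, false), hu, by simpa using ⟨a', h4⟩⟩
  choose f hf1 hf2 using hblocked
  have hcard : ((G.graph.neighborSet v).toFinite.toFinset ×ˢ (Finset.univ : Finset Bool)).card <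
      (Finset.univ : Finset (Fin (2 * Δ + 1))).card := by
    have := G.degree_le v
    rw [Set.ncard_eq_toFinset_card _ (Set.toFinite _)] at this
    rw [Finset.card_product]
    simp only [Finset.card_univ, Fintype.card_bool, Fintype.card_fin]
    omega
  obtain ⟨i, -, j, -, hij, hfij⟩ := Finset.exists_ne_map_eq_of_card_lt_of_maps_to hcard
    (f := f) (fun j _ => by simpa using hf1 j)
  wlog hlt : i < j generalizing i j
  · exact this j i hij.symm hfij.symm (lt_of_le_of_ne (not_lt.1 hlt) hij.symm)
  obtain ⟨d, hd⟩ := Nat.exists_eq_add_of_lt hlt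
  have hTj : T + (j : ℕ) = T + i + (d + 1) := by omega
  -- The two rounds are at most 2Δ < q apart, so their difference is invertible modulo q.
  have hd0 : ((d + 1 : ℕ) : ZMod S.q) ≠ 0 := by
    rw [Ne, ZMod.natCast_eq_zero_iff]
    intro hdvd
    have := Nat.le_of_dvd (Nat.succ_pos d) hdvd
    have := S.two_mul_lt
    have := j.2
    omega
  have hadj := hf1 i
  have hu := G.mem_of_adj _ _ hadj.symm
  have hi := hf2 i
  have hj := hf2 j
  rw [← hfij] at hj
  have hjcast : ((j : ℕ) : ZMod S.q) = (i : ℕ) + ((d + 1 : ℕ) : ZMod S.q) := by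
    rw [hd]; push_cast; ring
  rw [hTj] at hj
  split_ifs at hi hj with hb
  · have := h.post_of_post (by omega) hu hi hj
    rw [hjcast] at this
    have h5 : ((d + 1 : ℕ) : ZMod S.q) * a = 0 := by linear_combination this
    rcases mul_eq_zero.1 h5 with h6 | h6
    · exact hd0 h6
    · exact ha h6
  · obtain ⟨a₁, h2⟩ := hi
    obtain ⟨a₂, h3⟩ := hj
    obtain ⟨b', h4, h5⟩ := h.work_of_work (by omega) hu _ h3
    rw [h2] at h4
    obtain ⟨rfl, rfl⟩ := State.work.inj h4
    rw [hjcast] at h5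
    have h6 : ((d + 1 : ℕ) : ZMod S.q) * (a - a₁) = 0 := by linear_combination h5
    rcases mul_eq_zero.1 h6 with h7 | h7
    · exact hd0 h7
    · refine h.proper (t := T + i) (by omega) hadj ?_
      rw [hwork i (by omega), h2, sub_eq_zero.1 h7]

/-- A vertex keeps waiting only because of a posted neighbour with a larger value one round earlier.
Following these blockers back j rounds raises the value by at least j, and values stay below q. -/
theorem val_add_lt_of_post (h : Run S G σ) {t : ℕ} (ht : S.depth + 2 + (2 * Δ + 1) ≤ t) (j : ℕ)
    {v : Fin n} (hv : v ∈ G.verts) {b : ZMod S.q} (h1 : σ (t + j) v = .post b) :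
    b.val + j < S.q := by
  induction j generalizing v b with
  | zero => exact ZMod.val_lt b
  | succ j ih =>
    rw [← add_assoc, h.succ_eq_advance (by omega) hv] at h1
    rcases advance_eq_post h1 with ⟨-, b', hb', u, hu, h2⟩ | ⟨a, h2, -⟩
    · have := ih (G.mem_of_adj _ _ hu.symm) h2
      omega
    · exact absurd h2 (h.ne_work (by omega) hv a b)

theorem exists_final (h : Run S G σ) {t : ℕ} (ht : S.depth + 2 + (2 * Δ + 1) + S.q ≤ t) {v : Fin n}
    (hv : v ∈ G.verts) : ∃ i, σ t v = .final i := by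
  rcases h1 : σ t v with i | b | ⟨a, b⟩ | ⟨k, c⟩
  · exact ⟨i, rfl⟩
  · obtain ⟨t, rfl⟩ := Nat.exists_eq_add_of_le' (show S.q ≤ t by omega)
    have := h.val_add_lt_of_post (by omega) _ hv h1
    omega
  · exact absurd h1 (h.ne_work (by omega) hv a b)
  · exact absurd h1 (h.ne_lin (by omega) hv k c)

end Run

/-! ### Encoding the states as colours -/

variable (S)

/-- The encoding of the states by natural numbers, where the final states come first. -/
noncomputable def encode : S.State ≃ Fin (Δ + 1 + Nat.card S.Pending) :=
  S.stateEquivSum.trans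
    (((Equiv.refl _).sumCongr (Finite.equivFin S.Pending)).trans finSumFinEquiv)

theorem encode_lt_iff (s : S.State) : (S.encode s : ℕ) < Δ + 1 ↔ ∃ i, s = .final i := by
  rcases s with i | b | ⟨a, b⟩ | ⟨k, c⟩ <;> simp [encode, stateEquivSum] <;> omega

/-- The self-stabilizing colouring algorithm given by a reduction scheme. -/
noncomputable def algorithm : Algorithm n Δ where
  palette := Δ + 1 + Nat.card S.Pending
  le_palette := Nat.le_add_right _ _
  next v s N := S.encode (next v (S.encode.symm s) (S.encode ⁻¹' N))

/-- The states given by a colouring. -/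
noncomputable def decode (c : S.algorithm.Coloring) (v : Fin n) : S.State :=
  S.encode.symm (c v)

theorem encode_decode (c : S.algorithm.Coloring) (v : Fin n) : S.encode (S.decode c v) = c v :=
  S.encode.apply_symm_apply _

theorem decode_ne_iff (c c' : S.algorithm.Coloring) (u v : Fin n) :
    S.decode c u ≠ S.decode c' v ↔ c u ≠ c' v :=
  S.encode.symm.injective.ne_iff

theorem coe_lt_iff (c : S.algorithm.Coloring) (v : Fin n) :
    (c v : ℕ) < Δ + 1 ↔ ∃ i, S.decode c v = .final i := by
  rw [← encode_lt_iff, encode_decode]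

theorem decode_step (G : Network n Δ) (c : S.algorithm.Coloring) (v : Fin n) :
    S.decode (S.algorithm.step G c) v =
      next v (S.decode c v) (neighborStates G.graph (S.decode c) v) := by
  have : S.encode ⁻¹' (c '' G.graph.neighborSet v) = neighborStates G.graph (S.decode c) v := by
    ext s
    simp only [Set.mem_preimage, mem_neighborStates]
    exact exists_congr fun u => and_congr_right fun _ => S.encode.symm_apply_eq.symm
  rw [← this]
  exact S.encode.symm_apply_apply _

theorem step_ne (G : Network n Δ) (c : S.algorithm.Coloring) {u v : Fin n}
    (h : G.graph.Adj u v) : S.algorithm.step G c u ≠ S.algorithm.step G c v := by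
  rw [← decode_ne_iff, decode_step, decode_step]
  exact next_neighborStates_ne G _ h

theorem step_eq_self (G : Network n Δ) (c : S.algorithm.Coloring) {v : Fin n}
    (hv : (c v : ℕ) < Δ + 1) (h : ∀ u, G.graph.Adj v u → c u ≠ c v) :
    S.algorithm.step G c v = c v := by
  obtain ⟨i, hi⟩ := (S.coe_lt_iff c v).1 hv
  by_contra hne
  rw [← ne_eq, ← decode_ne_iff, decode_step, hi] at hne
  refine hne (next_final ?_)
  rintro ⟨u, hu, h2⟩
  rw [← hi] at h2
  exact (S.decode_ne_iff c c u v).2 (h u hu) h2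

theorem step_ne_self (G : Network n Δ) (c : S.algorithm.Coloring) {u v : Fin n}
    (hv : (c v : ℕ) < Δ + 1) (h : G.graph.Adj v u) (huv : c u = c v) :
    S.algorithm.step G c v ≠ c v := by
  obtain ⟨i, hi⟩ := (S.coe_lt_iff c v).1 hv
  rw [← decode_ne_iff, decode_step, hi, next_of_not_valid]
  · exact fun h => by cases h
  · intro h1
    exact h1.1 ⟨u, h, by rw [← hi, decode, decode, huv]⟩

end ReductionScheme

/-! ### Executions with faults and the adjustment radius -/

namespace Algorithm

variable {n Δ : ℕ} {A : Algorithm n Δ} {e : A.Execution} {t₀ : ℕ}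

theorem Execution.not_disturbed_iff {t : ℕ} {v : Fin n} : ¬ e.Disturbed t v ↔
    (v ∈ (e.net t).verts ↔ v ∈ (e.net (t + 1)).verts) ∧
    (e.net t).graph.neighborSet v = (e.net (t + 1)).graph.neighborSet v ∧
    (v ∈ (e.net (t + 1)).verts → e.ram (t + 1) v = A.step (e.net t) (e.ram t) v) := by
  simp only [Execution.Disturbed]
  tauto

theorem Execution.not_disturbed_of_notMem {v : Fin n} (h : v ∉ e.disturbedSince t₀) {t : ℕ}
    (ht : t₀ ≤ t) : ¬ e.Disturbed t v :=
  fun h1 => h ⟨t, ht, h1⟩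

theorem Execution.QuietFrom.net_fields_eq (h : e.QuietFrom t₀) (j : ℕ) :
    (e.net (t₀ + j)).verts = (e.net t₀).verts ∧ (e.net (t₀ + j)).graph = (e.net t₀).graph := by
  induction j with
  | zero => exact ⟨rfl, rfl⟩
  | succ j ih =>
    have h1 : ∀ v, _ := fun v => Execution.not_disturbed_iff.1
      (Execution.not_disturbed_of_notMem (t₀ := t₀) (t := t₀ + j) (e := e) (v := v)
        (by rw [h]; exact Set.notMem_empty _) (by omega))
    refine ⟨(Set.ext fun v => (h1 v).1.symm).trans ih.1, Eq.trans ?_ ih.2⟩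
    ext u v
    exact (Set.ext_iff.1 (h1 u).2.1 v).symm

theorem Execution.QuietFrom.net_eq (h : e.QuietFrom t₀) (j : ℕ) : e.net (t₀ + j) = e.net t₀ := by
  obtain ⟨h1, h2⟩ := h.net_fields_eq j
  revert h1 h2
  rcases e.net (t₀ + j) with ⟨V, G, _, _⟩
  rcases e.net t₀ with ⟨V', G', _, _⟩
  rintro rfl rfl
  rfl

theorem Execution.QuietFrom.ram_succ (h : e.QuietFrom t₀) (j : ℕ) {v : Fin n}
    (hv : v ∈ (e.net t₀).verts) :
    e.ram (t₀ + (j + 1)) v = A.step (e.net t₀) (e.ram (t₀ + j)) v := by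
  have h1 := Execution.not_disturbed_iff.1
      (Execution.not_disturbed_of_notMem (t₀ := t₀) (t := t₀ + j) (e := e) (v := v)
        (by rw [h]; exact Set.notMem_empty _) (by omega))
  rw [← h.net_eq j]
  refine h1.2.2 ?_
  rwa [add_assoc, h.net_eq (j + 1)]

/-- If the colouring is solved and neither `v` nor its neighbours are disturbed any more, then `v`
keeps its colour, and its neighbours keep avoiding this colour. -/
theorem Execution.ram_eq_of_undisturbed
    (hne : ∀ G c u v, (G : Network n Δ).graph.Adj u v → A.step G c u ≠ A.step G c v)
    (hself : ∀ G c v, (c v : ℕ) < Δ + 1 → (∀ u, (G : Network n Δ).graph.Adj v u → c u ≠ c v) →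
      A.step G c v = c v)
    (h : e.SolvedAt t₀) {v : Fin n} (hv : v ∈ (e.net t₀).verts) (hd : v ∉ e.disturbedSince t₀)
    (hd' : ∀ u, (e.net t₀).graph.Adj v u → u ∉ e.disturbedSince t₀) (j : ℕ) :
    v ∈ (e.net (t₀ + j)).verts ∧
      (e.net (t₀ + j)).graph.neighborSet v = (e.net t₀).graph.neighborSet v ∧
      e.ram (t₀ + j) v = e.ram t₀ v ∧
      ∀ u, (e.net t₀).graph.Adj v u → e.ram (t₀ + j) u ≠ e.ram t₀ v := by
  induction j with
  | zero => exact ⟨hv, rfl, rfl, fun u hu => (h.1 v u hu).symm⟩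
  | succ j ih =>
    obtain ⟨h1, h2, h3, h4⟩ := ih
    obtain ⟨h5, h6, h7⟩ := Execution.not_disturbed_iff.1
      (Execution.not_disturbed_of_notMem hd (Nat.le_add_right t₀ j))
    have hadj : ∀ u, (e.net t₀).graph.Adj v u ↔ (e.net (t₀ + j)).graph.Adj v u :=
      fun u => (Set.ext_iff.1 h2 u).symm
    have hadj' : ∀ u, (e.net t₀).graph.Adj v u ↔ (e.net (t₀ + (j + 1))).graph.Adj v u :=
      fun u => (hadj u).trans (Set.ext_iff.1 h6 u)
    have hstep : A.step (e.net (t₀ + j)) (e.ram (t₀ + j)) v = e.ram t₀ v := by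
      rw [← h3]
      refine hself _ _ _ ?_ fun u hu => ?_
      · rw [h3]; exact h.2 v hv
      · rw [h3]; exact h4 u ((hadj u).2 hu)
    refine ⟨h5.1 h1, h6.symm.trans h2, (h7 (h5.1 h1)).trans hstep, fun u hu => ?_⟩
    obtain ⟨-, -, h8⟩ := Execution.not_disturbed_iff.1
      (Execution.not_disturbed_of_notMem (hd' u hu) (Nat.le_add_right t₀ j))
    rw [← add_assoc, h8 ((e.net (t₀ + (j + 1))).mem_of_adj _ _ ((hadj' u).1 hu).symm), ← hstep]
    exact hne _ _ _ _ ((hadj u).1 hu).symm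

/-- If no disturbed vertex lies within distance 1 of v, then `Execution.ram_eq_of_undisturbed`
freezes the colour of v. Neighbours may react to remote faults, but their computed colours still
differ from that of v. -/
theorem adjustmentRadius_le_one
    (hne : ∀ G c u v, (G : Network n Δ).graph.Adj u v → A.step G c u ≠ A.step G c v)
    (hself : ∀ G c v, (c v : ℕ) < Δ + 1 → (∀ u, (G : Network n Δ).graph.Adj v u → c u ≠ c v) →
      A.step G c v = c v) : A.adjustmentRadius ≤ 1 := by
  refine iSup_le fun e => iSup_le fun t₀ => iSup_le fun h => iSup_le fun v => iSup_le fun hv =>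
    iSup_le fun ⟨t, ht, hc⟩ => ?_
  by_contra hlt
  refine hc ?_
  obtain ⟨j, rfl⟩ := Nat.exists_eq_add_of_le ht
  refine (Execution.ram_eq_of_undisturbed hne hself h hv (fun hd => hlt ?_)
    (fun u hu hd => hlt ?_) j).2.2.1
  · exact (iInf₂_le v hd).trans (by simp)
  · exact (iInf₂_le u hd).trans (SimpleGraph.edist_eq_one_iff_adj.2 hu).le

theorem properInEachRound_of_step_ne
    (hne : ∀ G c u v, (G : Network n Δ).graph.Adj u v → A.step G c u ≠ A.step G c v) :
    A.ProperInEachRound := by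
  intro e t₀ h t ht u v huv
  obtain ⟨j, rfl⟩ : ∃ j, t = t₀ + (j + 1) := ⟨t - t₀ - 1, by omega⟩
  rw [h.net_eq] at huv
  rw [h.ram_succ j ((e.net t₀).mem_of_adj _ _ huv),
    h.ram_succ j ((e.net t₀).mem_of_adj _ _ huv.symm)]
  exact hne _ _ _ _ huv

/-- The network on all IDs with the single edge from `u` to `v`. -/
def edgeNetwork (u v : Fin n) (hΔ : 1 ≤ Δ) : Network n Δ where
  verts := Set.univ
  graph := SimpleGraph.edge u v
  mem_of_adj _ _ _ := Set.mem_univ _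
  degree_le w := by
    refine (Set.ncard_le_ncard (t := {if w = u then v else u}) ?_ (Set.toFinite _)).trans
      ((Set.ncard_singleton _).le.trans hΔ)
    intro x hx
    rw [SimpleGraph.mem_neighborSet, SimpleGraph.edge_adj] at hx
    rw [Set.mem_singleton_iff]
    split_ifs <;> grind

open Classical in
/-- The contents of the RAM in a run on a fixed network where the vertices start with the colours
`c` and `u` gets the colour `x` in the first round by a fault. -/
noncomputable def faultRun (A : Algorithm n Δ) (G : Network n Δ) (c : A.Coloring) (u : Fin n)
    (x : Fin A.palette) : ℕ → A.Coloring
  | 0 => c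
  | 1 => Function.update (A.step G c) u x
  | t + 2 => A.step G (faultRun A G c u x (t + 1))

/-- On a single edge a fault copies the colour of v to u. Only u is disturbed, yet v has to react to
the conflict. -/
theorem one_le_adjustmentRadius (hn : 2 ≤ n) (hΔ : 1 ≤ Δ)
    (hself : ∀ G c u v, (c v : ℕ) < Δ + 1 → (G : Network n Δ).graph.Adj v u → c u = c v →
      A.step G c v ≠ c v) : 1 ≤ A.adjustmentRadius := by
  have hp := A.le_palette
  let v : Fin n := ⟨0, by omega⟩
  let u : Fin n := ⟨1, by omega⟩
  have hvu : v ≠ u := by simp [v, u]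
  let G : Network n Δ := edgeNetwork v u hΔ
  let x : Fin A.palette := ⟨0, by omega⟩
  let y : Fin A.palette := ⟨1, by omega⟩
  have hxy : x ≠ y := by simp [x, y]
  let c : A.Coloring := fun w => if w = u then y else x
  have hcu : c u = y := if_pos rfl
  have hcv : c v = x := if_neg hvu
  have hG : G.graph.Adj v u := (SimpleGraph.edge_adj _ _ _ _).2 ⟨.inl ⟨rfl, rfl⟩, hvu⟩
  let e : A.Execution := ⟨fun _ => G, faultRun A G c u x⟩
  have hsolved : e.SolvedAt 0 := by
    constructor
    · intro a b hab
      rcases (SimpleGraph.edge_adj _ _ _ _).1 hab with ⟨⟨rfl, rfl⟩ | ⟨rfl, rfl⟩, -⟩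
      · change c v ≠ c u
        rwa [hcu, hcv]
      · change c u ≠ c v
        rw [hcu, hcv]
        exact hxy.symm
    · intro w _
      change (c w : ℕ) < Δ + 1
      simp only [c]
      split_ifs <;> simp only [x, y] <;> omega
  have hundisturbed : ∀ w, w ≠ u → w ∉ e.disturbedSince 0 := by
    rintro w hw ⟨t, -, h1 | h1 | ⟨-, h1⟩⟩
    · exact h1 Iff.rfl
    · exact h1 rfl
    · rcases t with - | t
      · exact h1 (Function.update_of_ne hw _ _)
      · exact h1 rfl
  have hchange : ∃ t, 0 ≤ t ∧ e.ram t v ≠ e.ram 0 v := by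
    by_contra! h
    have h1 : faultRun A G c u x 1 v = c v := h 1 (Nat.zero_le _)
    -- If v kept its colour through time 1, it would conflict with u there and change by time 2.
    refine hself G (faultRun A G c u x 1) u v ?_ hG ?_ ?_
    · rw [h1, hcv]
      exact Nat.succ_pos _
    · rw [h1, hcv]
      exact Function.update_self _ _ _
    · exact (h 2 (Nat.zero_le _)).trans h1.symm
  refine le_trans ?_ (le_iSup_of_le e (le_iSup_of_le 0 (le_iSup_of_le hsolved
    (le_iSup_of_le v (le_iSup_of_le (Set.mem_univ _) (le_iSup_of_le hchange le_rfl))))))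
  refine le_iInf₂ fun w hw => ?_
  have hwu : w = u := by
    by_contra hwu
    exact hundisturbed w hwu hw
  rw [hwu]
  exact Order.one_le_iff_ne_zero.2 (SimpleGraph.edist_pos_of_ne hvu).ne'

end Algorithm

theorem ReductionScheme.stabilizesWithin {n Δ : ℕ} (S : ReductionScheme n Δ) {T : ℕ}
    (hT : S.depth + 2 + (2 * Δ + 1) + S.q ≤ T) : S.algorithm.StabilizesWithin T := by
  intro e t₀ h t ht
  have hrun : Run S (e.net t₀) fun j => S.decode (e.ram (t₀ + j)) := by
    refine ⟨fun j v hv => ?_⟩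
    rw [← decode_step, decode, h.ram_succ j hv]
    rfl
  have hq := S.prime.out.pos
  obtain ⟨j, rfl⟩ := Nat.exists_eq_add_of_le (show t₀ ≤ t by omega)
  refine ⟨fun u v huv => ?_, fun v hv => ?_⟩
  · rw [h.net_eq] at huv
    exact (S.decode_ne_iff _ _ _ _).1 (hrun.proper (t := j) (by omega) huv)
  · rw [h.net_eq] at hv
    exact (S.coe_lt_iff _ _).2 (hrun.exists_final (t := j) (by omega) hv)

/-! ### Linial's reduction by polynomials -/

/-- Colours are encoded as polynomials of degree below D over the field with p elements. There are p
^ D of them, and two distinct ones agree only at roots of their difference. -/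
theorem exists_family_agreeing_rarely (p : ℕ) [Fact p.Prime] {m D : ℕ} (h : m ≤ p ^ D) :
    ∃ f : Fin m → ZMod p → ZMod p, ∀ a b, a ≠ b → {x | f a x = f b x}.ncard ≤ D := by
  have hcard : Fintype.card (Fin m) ≤ Fintype.card (Fin D → ZMod p) := by
    simpa [ZMod.card] using h
  obtain ⟨g⟩ := Function.Embedding.nonempty_of_card_le hcard
  let P : Fin m → Polynomial.degreeLT (ZMod p) D :=
    fun a => (Polynomial.degreeLTEquiv (ZMod p) D).symm (g a)
  refine ⟨fun a x => (P a).1.eval x, fun a b hab => ?_⟩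
  have hne : (P a).1 - (P b).1 ≠ 0 := by
    rw [sub_ne_zero]
    intro h
    exact hab (g.injective ((Polynomial.degreeLTEquiv (ZMod p) D).symm.injective (Subtype.ext h)))
  have hdeg : ((P a).1 - (P b).1).natDegree ≤ D := by
    refine Polynomial.natDegree_le_of_degree_le (le_of_lt ?_)
    exact Polynomial.mem_degreeLT.1 (Submodule.sub_mem _ (P a).2 (P b).2)
  classical
  refine le_trans ?_ ((Polynomial.card_roots' _).trans hdeg)
  refine le_trans ?_ (Multiset.toFinset_card_le _)
  rw [← Set.ncard_coe_finset]
  refine Set.ncard_le_ncard (fun x hx => ?_) (Finset.finite_toSet _)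
  simpa [hne, sub_eq_zero] using hx

/-- At most 1 + Δ + ΔD points are excluded: zero, the elements of F, and the agreements with each
neighbouring colour. -/
theorem exists_notMem_forall_ne {p m D Δ : ℕ} [Fact p.Prime] (hp : Δ * D + Δ + 1 < p)
    {f : Fin m → ZMod p → ZMod p} (hf : ∀ a b, a ≠ b → {x | f a x = f b x}.ncard ≤ D)
    (a : Fin m) {A : Set (Fin m)} {F : Set (ZMod p)} (hA : A.ncard ≤ Δ) (hF : F.ncard ≤ Δ) :
    ∃ x, x ≠ 0 ∧ x ∉ F ∧ ∀ b ∈ A, a ≠ b → f a x ≠ f b x := by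
  classical
  let bad : Finset (ZMod p) := insert 0 (F.toFinite.toFinset ∪
    (A.toFinite.toFinset.filter (a ≠ ·)).biUnion fun b => Finset.univ.filter fun x => f a x = f b x)
  have hbad : bad.card < (Finset.univ : Finset (ZMod p)).card := by
    rw [Set.ncard_eq_toFinset_card _ (Set.toFinite _)] at hA hF
    have h1 : ((A.toFinite.toFinset.filter (a ≠ ·)).biUnion
        fun b => Finset.univ.filter fun x => f a x = f b x).card ≤
        (A.toFinite.toFinset.filter (a ≠ ·)).card * D := by
      refine Finset.card_biUnion_le_card_mul _ _ _ fun b hb => ?_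
      have := hf a b (Finset.mem_filter.1 hb).2
      rwa [Set.ncard_eq_toFinset_card', Set.toFinset_ofPred] at this
    have h2 : (A.toFinite.toFinset.filter (a ≠ ·)).card * D ≤ Δ * D :=
      Nat.mul_le_mul_right _ ((Finset.card_filter_le _ _).trans hA)
    have h3 := Finset.card_union_le F.toFinite.toFinset ((A.toFinite.toFinset.filter (a ≠ ·)).biUnion
        fun b => Finset.univ.filter fun x => f a x = f b x)
    have h4 : bad.card ≤ _ + 1 := Finset.card_insert_le _ _
    rw [Finset.card_univ, ZMod.card]
    omega
  obtain ⟨x, -, hx⟩ := Finset.exists_mem_notMem_of_card_lt_card hbad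
  simp only [bad, Finset.mem_insert, Finset.mem_union, Finset.mem_biUnion, Finset.mem_filter,
    Set.Finite.mem_toFinset, Finset.mem_univ, true_and, not_or, not_exists, not_and] at hx
  exact ⟨x, hx.1, hx.2.1, fun b hb hab => hx.2.2 b ⟨hb, hab⟩⟩

/-- One round of colour reduction (Linial): if `m ≤ p ^ D` and `p` exceeds `Δ D + Δ + 1`, then a
colour from `{0, …, m - 1}` can be replaced by a pair of elements of `ZMod p`. -/
theorem exists_reduction {p m D Δ : ℕ} [Fact p.Prime] (hp : Δ * D + Δ + 1 < p) (hm : m ≤ p ^ D) :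
    ∃ R : Fin m → Set (Fin m) → Set (ZMod p) → ZMod p × ZMod p,
      (∀ a A F, A.ncard ≤ Δ → F.ncard ≤ Δ → (R a A F).1 ≠ 0 ∧ (R a A F).1 ∉ F) ∧
      ∀ a b A B F F', a ≠ b → b ∈ A → a ∈ B → A.ncard ≤ Δ → B.ncard ≤ Δ →
        F.ncard ≤ Δ → F'.ncard ≤ Δ → R a A F ≠ R b B F' := by
  classical
  obtain ⟨f, hf⟩ := exists_family_agreeing_rarely p hm
  have h : ∀ (a : Fin m) (A : Set (Fin m)) (F : Set (ZMod p)), ∃ x, A.ncard ≤ Δ → F.ncard ≤ Δ →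
      x ≠ 0 ∧ x ∉ F ∧ ∀ b ∈ A, a ≠ b → f a x ≠ f b x := by
    intro a A F
    by_cases hAF : A.ncard ≤ Δ ∧ F.ncard ≤ Δ
    · obtain ⟨x, hx⟩ := exists_notMem_forall_ne hp hf a hAF.1 hAF.2
      exact ⟨x, fun _ _ => hx⟩
    · exact ⟨0, fun h1 h2 => absurd ⟨h1, h2⟩ hAF⟩
  choose X hX using h
  refine ⟨fun a A F => (X a A F, f a (X a A F)),
    fun a A F hA hF => ⟨(hX a A F hA hF).1, (hX a A F hA hF).2.1⟩, ?_⟩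
  intro a b A B F F' hab hbA _ hA _ hF _ h
  obtain ⟨h1, h2⟩ := Prod.ext_iff.1 h
  exact (hX a A F hA hF).2.2 b hbA hab (h2.trans (congrArg (f b) h1.symm))

/-! ### Colour lengths along the chain and log* -/

theorem two_pow_clog_le {x : ℕ} (hx : 2 ≤ x) : 2 ^ Nat.clog 2 x ≤ 2 * (x - 1) := by
  have h := Nat.pow_pred_clog_lt_self (b := 2) one_lt_two hx
  have h1 := Nat.clog_pos one_lt_two hx
  rw [← Nat.succ_pred_eq_of_pos h1, pow_succ]
  omega

/-- The number of bits of the colours on the levels of the chain of reductions. -/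
def bits (n δ : ℕ) : ℕ → ℕ
  | 0 => Nat.clog 2 n
  | k + 1 => 2 * Nat.clog 2 (bits n δ k + 2) + 2 * δ + 2

theorem exists_reduce {Δ δ : ℕ} (hδ : Δ + 1 ≤ 2 ^ δ) (n k : ℕ) :
    ∃ R : Fin (2 ^ bits n δ k) → Set (Fin (2 ^ bits n δ k)) → Fin (2 ^ bits n δ (k + 1)),
      ∀ a b A B, a ≠ b → b ∈ A → a ∈ B → A.ncard ≤ Δ → B.ncard ≤ Δ → R a A ≠ R b B := by
  obtain ⟨p, hp, hlt, hle⟩ := Nat.exists_prime_lt_and_le_two_mul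
    (2 ^ (Nat.clog 2 (bits n δ k + 2) + δ)) (by positivity)
  have : Fact p.Prime := ⟨hp⟩
  have h1 : Δ * bits n δ k + Δ + 1 < p := by
    refine lt_of_le_of_lt ?_ hlt
    rw [pow_add]
    refine le_trans ?_ (Nat.mul_le_mul (Nat.le_pow_clog one_lt_two _) hδ)
    nlinarith
  -- The exponent D is the current number of bits, which suffices because p ≥ 2.
  obtain ⟨R, -, hR⟩ := exists_reduction h1 (Nat.pow_le_pow_left hp.two_le (bits n δ k))
  have hcard : Fintype.card (ZMod p × ZMod p) ≤ Fintype.card (Fin (2 ^ bits n δ (k + 1))) := by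
    rw [Fintype.card_prod, ZMod.card, Fintype.card_fin]
    refine (Nat.mul_le_mul hle hle).trans (le_of_eq ?_)
    rw [bits]
    ring
  obtain ⟨g⟩ := Function.Embedding.nonempty_of_card_le hcard
  refine ⟨fun a A => g (R a A ∅), fun a b A B hab hbA haB hA hB h => ?_⟩
  exact hR a b A B ∅ ∅ hab hbA haB hA hB (by simp) (by simp) (g.injective h)

/-- Above 2 each logarithm loses at least 1. This makes the iteration terminate within n steps and
keeps the iterates decreasing. -/
theorem logb_two_le_sub_one {y : ℝ} (hy : 2 ≤ y) : Real.logb 2 y ≤ y - 1 := by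
  have h1 := Real.log_le_sub_one_of_pos (show 0 < y / 2 by linarith)
  have h2 := Real.log_two_gt_d9
  rw [Real.log_div (by linarith) two_ne_zero] at h1
  rw [Real.logb, div_le_iff₀ (by linarith)]
  nlinarith

theorem two_le_iterate_of_lt_logStar {x : ℝ} {k : ℕ} (h : k < logStar x) :
    2 ≤ (Real.logb 2)^[k] x :=
  not_lt.1 (Nat.notMem_of_lt_sInf h)

theorem exists_iterate_lt_two (n : ℕ) : ∃ k ≤ n, (Real.logb 2)^[k] n < 2 := by
  by_contra! h
  have h1 : ∀ k ≤ n, (Real.logb 2)^[k] n ≤ n - k := by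
    intro k
    induction k with
    | zero => simp
    | succ k ih =>
      intro hk
      rw [Function.iterate_succ_apply']
      have := logb_two_le_sub_one (h k (by omega))
      have := ih (by omega)
      push_cast
      linarith
  have := h1 n le_rfl
  have := h n le_rfl
  linarith

theorem logStar_natCast_le (n : ℕ) : logStar n ≤ n := by
  obtain ⟨k, hk, h⟩ := exists_iterate_lt_two n
  exact (Nat.sInf_le h).trans hk

theorem iterate_logStar_lt (n : ℕ) : (Real.logb 2)^[logStar n] n < 2 := by
  obtain ⟨k, -, h⟩ := exists_iterate_lt_two n
  exact Nat.sInf_mem (s := {k : ℕ | (Real.logb 2)^[k] (n : ℝ) < 2}) ⟨k, h⟩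

theorem clog_two_le (x : ℕ) : (Nat.clog 2 x : ℝ) ≤ Real.logb 2 x + 1 := by
  rcases Nat.eq_zero_or_pos x with rfl | hx
  · simp
  · rw [← Real.natCeil_logb_natCast]
    exact (Nat.ceil_lt_add_one
      (Real.logb_nonneg one_lt_two (by exact_mod_cast hx))).le

/-- A reduction step roughly takes the logarithm of the bit length, up to a factor 2 and an additive
O(δ). These errors do not accumulate, since the next logarithm absorbs them. -/
theorem bits_le (n δ : ℕ) {k : ℕ} (hk : k = 0 ∨ k < logStar n) :
    (Real.logb 2)^[k + 1] n ≤ Real.logb 2 n ∧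
      (bits n δ k : ℝ) ≤ 2 * (Real.logb 2)^[k + 1] n + 4 * δ + 16 := by
  have hδ : (0 : ℝ) ≤ δ := Nat.cast_nonneg δ
  induction k with
  | zero =>
    refine ⟨by simp, ?_⟩
    have h1 := clog_two_le n
    have h2 : 0 ≤ Real.logb 2 n := by
      rcases Nat.eq_zero_or_pos n with rfl | hn
      · simp
      · exact Real.logb_nonneg one_lt_two (by exact_mod_cast hn)
    simp only [bits, zero_add, Function.iterate_one]
    linarith
  | succ k ih =>
    have hk' : k + 1 < logStar n := by omega
    obtain ⟨h1, h2⟩ := ih (by omega)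
    have h3 := two_le_iterate_of_lt_logStar hk'
    rw [Function.iterate_succ_apply' _ (k + 1)]
    set x := (Real.logb 2)^[k + 1] (n : ℝ) with hx
    refine ⟨by linarith [logb_two_le_sub_one h3], ?_⟩
    have h4 := clog_two_le (bits n δ k + 2)
    have h5 : (δ : ℝ) + 1 ≤ 2 ^ δ := by
      exact_mod_cast Nat.succ_le_of_lt Nat.lt_two_pow_self
    have h6 : ((bits n δ k + 2 : ℕ) : ℝ) ≤ 2 ^ 5 * (x * 2 ^ δ) := by
      push_cast
      nlinarith
    have h7 := Real.logb_le_logb_of_le one_lt_two (by positivity) h6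
    rw [Real.logb_mul (by positivity) (by positivity), Real.logb_mul (by positivity) (by positivity),
      Real.logb_pow, Real.logb_pow, Real.logb_self_eq_one one_lt_two] at h7
    rw [bits]
    push_cast at h4 h7 ⊢
    linarith

theorem bits_le_of_pred_logStar (n δ : ℕ) : bits n δ (logStar n - 1) ≤ 4 * δ + 20 := by
  have h1 := (bits_le n δ (k := logStar n - 1) (by omega)).2
  have h2 : (Real.logb 2)^[logStar n - 1 + 1] n ≤ 2 := by
    -- If `logStar n = 0`, the truncated subtraction leaves one logarithm to evaluate, for n = 0 or
    -- n = 1.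
    rcases Nat.eq_zero_or_pos (logStar n) with h | h
    · have h3 := iterate_logStar_lt n
      rw [h] at h3 ⊢
      have h4 : n < 2 := Nat.cast_lt_ofNat.1 h3
      interval_cases n <;> simp
    · rw [Nat.sub_add_cancel h]
      exact (iterate_logStar_lt n).le
  have h3 : (bits n δ (logStar n - 1) : ℝ) ≤ 4 * δ + 20 := by linarith
  exact_mod_cast h3

theorem bits_le_clog (n δ : ℕ) {k : ℕ} (hk : k ≤ logStar n - 1) :
    bits n δ k ≤ 2 * Nat.clog 2 n + 4 * δ + 16 := by
  obtain ⟨h1, h2⟩ := bits_le n δ (k := k) (by omega)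
  have h3 : Real.logb 2 n ≤ Nat.clog 2 n := by
    rw [← Real.natCeil_logb_natCast]
    exact Nat.le_ceil _
  have h4 : (bits n δ k : ℝ) ≤ 2 * Nat.clog 2 n + 4 * δ + 16 := by linarith
  exact_mod_cast h4

theorem two_pow_bits_le {n Δ : ℕ} (hΔ : 1 ≤ Δ) {k : ℕ} (hk : k ≤ logStar n - 1) :
    2 ^ bits n (Nat.clog 2 (Δ + 1)) k ≤ (n + Δ + 2) ^ 28 := by
  obtain ⟨X, hX⟩ : ∃ X, X = n + Δ + 2 := ⟨_, rfl⟩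
  rw [← hX]
  have h2 : 2 ≤ X := by omega
  have h1 : 2 ^ Nat.clog 2 n ≤ X ^ 2 := by
    rcases lt_or_ge n 2 with h | h
    · interval_cases n <;> simpa using Nat.one_le_pow _ _ (by omega)
    · refine (two_pow_clog_le h).trans ?_
      rw [pow_two]
      exact Nat.mul_le_mul h2 (by omega)
  have h3 : 2 ^ Nat.clog 2 (Δ + 1) ≤ X ^ 2 := by
    refine (two_pow_clog_le (by omega)).trans ?_
    rw [pow_two]
    exact Nat.mul_le_mul h2 (by omega)
  calc 2 ^ bits n (Nat.clog 2 (Δ + 1)) k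
      ≤ 2 ^ (2 * Nat.clog 2 n + 4 * Nat.clog 2 (Δ + 1) + 16) :=
        Nat.pow_le_pow_right two_pos (bits_le_clog n _ hk)
    _ = (2 ^ Nat.clog 2 n) ^ 2 * (2 ^ Nat.clog 2 (Δ + 1)) ^ 4 * 2 ^ 16 := by ring
    _ ≤ (X ^ 2) ^ 2 * (X ^ 2) ^ 4 * X ^ 16 := by gcongr
    _ = X ^ 28 := by ring

/-! ### Choice of the parameters and conclusion -/

theorem exists_reductionScheme (n : ℕ) {Δ : ℕ} (hΔ : 1 ≤ Δ) :
    ∃ S : ReductionScheme n Δ, S.depth ≤ logStar n ∧ S.q ≤ 64 * Δ ∧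
      ∀ k ≤ S.depth, S.size k ≤ (n + Δ + 2) ^ 28 := by
  set δ := Nat.clog 2 (Δ + 1) with hδdef
  have hδ : Δ + 1 ≤ 2 ^ δ := Nat.le_pow_clog one_lt_two _
  -- The last level has at most 4δ + 20 ≤ 5(δ + 4) bits, so polynomials with D = 5 suffice over this
  -- field. Also q > 16(Δ + 1) exceeds 6Δ + 1, and q ≤ 32 · 2 ^ δ ≤ 64Δ.
  obtain ⟨q, hq, hlt, hle⟩ := Nat.exists_prime_lt_and_le_two_mul (2 ^ (δ + 4)) (by positivity)
  have hq' : Fact q.Prime := ⟨hq⟩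
  have h1 : Δ * 5 + Δ + 1 < q := by
    rw [pow_add] at hlt
    omega
  have h2 : q ≤ 64 * Δ := by
    have := two_pow_clog_le (show 2 ≤ Δ + 1 by omega)
    rw [← hδdef] at this
    rw [pow_add] at hle
    omega
  choose R hR using exists_reduce hδ n
  have hE : ∀ k, ∃ E : Fin (2 ^ bits n δ k) → Set (Fin (2 ^ bits n δ k)) → Set (ZMod q) →
      ZMod q × ZMod q, k = logStar n - 1 →
      (∀ a A F, A.ncard ≤ Δ → F.ncard ≤ Δ → (E a A F).1 ≠ 0 ∧ (E a A F).1 ∉ F) ∧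
      ∀ a b A B F F', a ≠ b → b ∈ A → a ∈ B → A.ncard ≤ Δ → B.ncard ≤ Δ →
        F.ncard ≤ Δ → F'.ncard ≤ Δ → E a A F ≠ E b B F' := by
    intro k
    by_cases hk : k = logStar n - 1
    · have h3 : 2 ^ bits n δ k ≤ q ^ 5 := by
        refine le_trans ?_ (Nat.pow_le_pow_left hlt.le 5)
        rw [← pow_mul, hk]
        exact Nat.pow_le_pow_right two_pos ((bits_le_of_pred_logStar n δ).trans (by omega))
      obtain ⟨E, hE⟩ := exists_reduction h1 h3
      exact ⟨E, fun _ => hE⟩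
    · exact ⟨fun _ _ _ => 0, fun h => absurd h hk⟩
  choose E hE using hE
  refine ⟨
    { q := q
      prime := hq'
      two_mul_lt := by omega
      depth := logStar n - 1
      size := fun k => 2 ^ bits n δ k
      ident := Fin.castLE (Nat.le_pow_clog one_lt_two n)
      ident_injective := Fin.castLE_injective _
      reduce := R
      reduce_ne := hR
      enter := E
      enter_fst := fun k hk => (hE k hk).1
      enter_ne := fun k hk => (hE k hk).2 }, Nat.sub_le _ _, h2, fun k hk => two_pow_bits_le hΔ hk⟩

theorem add_add_le_pow {X a q s : ℕ} (hX : 2 ≤ X) (ha : a ≤ X) (hq : q ≤ 64 * X)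
    (hs : s ≤ X * X ^ 28) : a + (q + (q * q + s)) ≤ X ^ 100 := by
  have hmono : ∀ {i j : ℕ}, i ≤ j → X ^ i ≤ X ^ j := fun h => Nat.pow_le_pow_right (by omega) h
  have hq7 : q ≤ X ^ 7 := calc
    q ≤ 2 ^ 6 * X := hq
    _ ≤ X ^ 6 * X := Nat.mul_le_mul_right _ (Nat.pow_le_pow_left hX 6)
    _ = X ^ 7 := (pow_succ X 6).symm
  have hqq : q * q ≤ X ^ 29 := calc
    q * q ≤ X ^ 7 * X ^ 7 := Nat.mul_le_mul hq7 hq7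
    _ = X ^ 14 := (pow_add X 7 7).symm
    _ ≤ X ^ 29 := hmono (by norm_num)
  have hs' : s ≤ X ^ 29 := hs.trans_eq (pow_succ' X 28).symm
  have h1 : a ≤ X ^ 29 := ha.trans (Nat.le_self_pow (by norm_num) X)
  have h7 : q ≤ X ^ 29 := hq7.trans (hmono (by norm_num))
  calc a + (q + (q * q + s)) ≤ 2 ^ 2 * X ^ 29 := by omega
    _ ≤ X ^ 2 * X ^ 29 := Nat.mul_le_mul_right _ (Nat.pow_le_pow_left hX 2)
    _ = X ^ 31 := (pow_add X 2 29).symm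
    _ ≤ X ^ 100 := hmono (by norm_num)

theorem ReductionScheme.palette_eq {n Δ : ℕ} (S : ReductionScheme n Δ) : S.algorithm.palette =
    Δ + 1 + (S.q + (S.q * S.q + ∑ k : Fin (S.depth + 1), S.size k)) := by
  change Δ + 1 + Nat.card S.Pending = _
  rw [Nat.card_sum, Nat.card_sum, Nat.card_prod, Nat.card_zmod, Nat.card_sigma]
  simp only [Nat.card_eq_fintype_card, Fintype.card_fin]

theorem ReductionScheme.palette_le {n Δ : ℕ} (S : ReductionScheme n Δ) (hd : S.depth ≤ logStar n)
    (hq : S.q ≤ 64 * Δ) (hs : ∀ k ≤ S.depth, S.size k ≤ (n + Δ + 2) ^ 28) :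
    S.algorithm.palette ≤ (n + Δ + 2) ^ 100 := by
  rw [S.palette_eq]
  refine add_add_le_pow (by omega) (by omega) (by omega) ?_
  refine (Finset.sum_le_card_nsmul Finset.univ (fun k : Fin (S.depth + 1) => S.size k) _
    fun k _ => hs k (Nat.le_of_lt_succ k.2)).trans ?_
  rw [Finset.card_univ, Fintype.card_fin, smul_eq_mul]
  have := logStar_natCast_le n
  exact Nat.mul_le_mul_right _ (by omega)

theorem exists_algorithm (n Δ : ℕ) : ∃ A : Algorithm n Δ,
    A.palette ≤ (n + Δ + 2) ^ 100 ∧ A.StabilizesWithin (100 * (Δ + logStar n)) ∧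
      A.ProperInEachRound ∧ A.adjustmentRadius ≤ 1 ∧
      (2 ≤ n → 1 ≤ Δ → A.adjustmentRadius = 1) := by
  -- For Δ = 0 the time bound may be 0, so a one-colour palette is used. For Δ ≥ 1 the additive
  -- constant 3 of the running time is absorbed into 100Δ.
  rcases Nat.eq_zero_or_pos Δ with rfl | hΔ
  · let A : Algorithm n 0 := ⟨1, le_rfl, fun _ _ _ => 0⟩
    have hadj : ∀ (G : Network n 0) u v, ¬ G.graph.Adj u v := fun G u v h => by
      have := (Set.ncard_eq_zero (Set.toFinite _)).1 (Nat.le_zero.1 (G.degree_le u))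
      exact Set.eq_empty_iff_forall_notMem.1 this v h
    have hne : ∀ G c u v, (G : Network n 0).graph.Adj u v → A.step G c u ≠ A.step G c v :=
      fun G _ u v h => absurd h (hadj G u v)
    refine ⟨A, Nat.one_le_pow _ _ (by omega), fun e t₀ _ t _ => ⟨fun u v h => absurd h (hadj _ u v),
      fun v _ => (e.ram t v).2⟩, Algorithm.properInEachRound_of_step_ne hne,
      Algorithm.adjustmentRadius_le_one hne fun _ c v _ _ =>
        (Subsingleton.elim (α := Fin 1) _ _), fun _ h => absurd h (by omega)⟩
  · obtain ⟨S, hd, hq, hs⟩ := exists_reductionScheme n hΔ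
    have h1 : S.algorithm.adjustmentRadius ≤ 1 :=
      Algorithm.adjustmentRadius_le_one (fun G c _ _ => S.step_ne G c)
        (fun G c _ => S.step_eq_self G c)
    exact ⟨S.algorithm, S.palette_le hd hq hs, S.stabilizesWithin (by omega),
      Algorithm.properInEachRound_of_step_ne (fun G c _ _ => S.step_ne G c), h1,
      fun hn _ => h1.antisymm
        (Algorithm.one_le_adjustmentRadius hn hΔ fun G c _ _ => S.step_ne_self G c)⟩

end SelfStab

theorem mainTheorem3 :
    ∃ (C : ℕ) (A : ∀ n Δ : ℕ, SelfStab.Algorithm n Δ), ∀ n Δ : ℕ,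
      (A n Δ).palette ≤ (n + Δ + 2) ^ C ∧
      (A n Δ).StabilizesWithin (C * (Δ + SelfStab.logStar n)) ∧
      (A n Δ).ProperInEachRound ∧
      (A n Δ).adjustmentRadius ≤ 1 ∧
      (2 ≤ n → 1 ≤ Δ → (A n Δ).adjustmentRadius = 1) :=
  ⟨100, fun n Δ => (SelfStab.exists_algorithm n Δ).choose,
    fun n Δ => (SelfStab.exists_algorithm n Δ).choose_spec⟩
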